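/- For $f,g:\mathbb F_2^n\to\mathbb R$ let $\langle f,g\rangle=2^{-n}\sum_x f(x)g(x)$ and $\|f\|_2=\sqrt{\langle f,f\rangle}$. For $\alpha\in\mathbb F_2^n$ let $\chi_\alpha(x)=(-1)^{\alpha\cdot x}$ and $\hat f(\alpha)=\langle f,\chi_\alpha\rangle$. Call $f$ $s$-sparse if at most $s$ of its Fourier coefficients $\hat f(\alpha)$ are nonzero, and $\tfrac13$-far from $s$-sparse in $\ell_2^2$ if $\inf_g\|f-g\|_2^2\ge\tfrac13$, the infimum being over all $s$-sparse $g$. A (randomized) non-adaptive algorithm with $q$ queries chooses points $x_1,\dots,x_q\in\mathbb F_2^n$ as a function of its random seed alone, receives $f(x_1),\dots,f(x_q)$, and accepts or rejects depending (measurably) on the seed and these values. Theorem. There is an absolute constant $c>0$ such that the following holds for all integers $n\ge1$ and $0\le s\le 2^{n-1}$ and all real $\varepsilon>0$. Suppose that a non-adaptive algorithm with $q$ queries satisfies, for every $f:\mathbb F_2^n\to\mathbb R$ with $1-\varepsilon\le\|f\|_2^2\le1+\varepsilon$: if $f$ is $s$-sparse, then it accepts with probability at least $\tfrac23$; if $f$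 is $\tfrac13$-far from $s$-sparse in $\ell_2^2$, then it rejects with probability at least $\tfrac23$. Then $q\ge c\sqrt s$. -/

import Mathlib

open MeasureTheory

namespace FourierSparsity

noncomputable section

/-- The vector space `𝔽₂ⁿ`. -/
abbrev F2 (n : ℕ) : Type := Fin n → ZMod 2

/-- The character `χ_α(x) = (-1)^(α · x)`. -/
def chi {n : ℕ} (α x : F2 n) : ℝ := (-1) ^ (dotProduct α x).val

/-- The inner product `⟨f, g⟩ = 2⁻ⁿ ∑ₓ f(x) g(x)`. -/
def innerE {n : ℕ} (f g : F2 n → ℝ) : ℝ := (1 / 2 ^ n) * ∑ x, f x * g x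

/-- The norm `‖f‖₂ = √⟨f, f⟩`. -/
def l2Norm {n : ℕ} (f : F2 n → ℝ) : ℝ := Real.sqrt (innerE f f)

/-- The Fourier coefficient of `f` at `α`, i.e. `2⁻ⁿ ∑ₓ f(x) χ_α(x)`. -/
def fourierCoeff {n : ℕ} (f : F2 n → ℝ) (α : F2 n) : ℝ := innerE f (chi α)

/-- The set of Fourier `s`-sparse functions: at most `s` Fourier coefficients are nonzero. -/
def sparse (n s : ℕ) : Set (F2 n → ℝ) := {f | {α | fourierCoeff f α ≠ 0}.ncard ≤ s}

/-- The `ℓ₂`-distance from `f` to a class `C` of functions. -/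
def l2Dist {n : ℕ} (f : F2 n → ℝ) (C : Set (F2 n → ℝ)) : ℝ :=
  sInf ((fun g => l2Norm (f - g)) '' C)

/-- `f` is `δ`-far from the class `C` in `ℓ₂²`. -/
def IsFar {n : ℕ} (δ : ℝ) (f : F2 n → ℝ) (C : Set (F2 n → ℝ)) : Prop :=
  δ ≤ l2Dist f C ^ 2

/-- A randomized non-adaptive algorithm making `q` queries to a function `𝔽₂ⁿ → ℝ`. It draws a
random seed `ω`; the query points depend on the seed alone; the output bit depends on the seed and
on the `q` answers. There is no bound on its computational power. Points may be queried repeatedly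
and answers may be ignored, so that algorithms making at most `q` queries are included. -/
structure NonAdaptiveAlgorithm (n q : ℕ) where
  /-- The space of random seeds. -/
  Seed : Type*
  [measurableSpace : MeasurableSpace Seed]
  /-- The distribution of the seed. -/
  law : Measure Seed
  [isProbabilityMeasure : IsProbabilityMeasure law]
  /-- The query points. -/
  query : Seed → Fin q → F2 n
  measurableSet_query : ∀ ξ : Fin q → F2 n, MeasurableSet {ω | query ω = ξ}
  /-- The output bit, given the seed and the answers; `true` means accept. -/
  output : Seed → (Fin q → ℝ) → Bool
  measurable_output : Measurable fun p : Seed × (Fin q → ℝ) => output p.1 p.2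

/-- The output of the algorithm on input `f` and seed `ω`. -/
def NonAdaptiveAlgorithm.run {n q : ℕ} (A : NonAdaptiveAlgorithm n q) (f : F2 n → ℝ)
    (ω : A.Seed) : Bool :=
  A.output ω fun i => f (A.query ω i)

/-- The probability that the algorithm outputs the bit `b` on input `f`. -/
def NonAdaptiveAlgorithm.prob {n q : ℕ} (A : NonAdaptiveAlgorithm n q) (f : F2 n → ℝ)
    (b : Bool) : ℝ :=
  letI := A.measurableSpace
  A.law.real {ω | A.run f ω = b}

/-- On every input `f` with `‖f‖₂² = 1 ± ε`, the algorithm accepts with probability at least `2/3`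
if `f` belongs to `C`, and rejects with probability at least `2/3` if `f` is `δ`-far from `C` in
`ℓ₂²`. -/
def NonAdaptiveAlgorithm.Distinguishes {n q : ℕ} (A : NonAdaptiveAlgorithm n q)
    (C : Set (F2 n → ℝ)) (δ ε : ℝ) : Prop :=
  ∀ f : F2 n → ℝ, |l2Norm f ^ 2 - 1| ≤ ε →
    (f ∈ C → 2 / 3 ≤ A.prob f true) ∧ (IsFar δ f C → 2 / 3 ≤ A.prob f false)

end

end FourierSparsity

namespace FourierSparsity

open Finset

/-! Two families of unit-norm functions look like `0` to a small query set. The normalized indicator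
of a subcube of codimension `k = Nat.log 2 s` has `2 ^ k ≤ s` nonzero Fourier coefficients; a
normalized point mass has a flat spectrum, so by Parseval it is far from sparse. Averaging over
translates, some translate is hit with probability at most `q / 2 ^ k` (`exists_prob_hit_le`);
otherwise all answers are zero. So the algorithm would both accept and reject `0` with probability
at least `2/3 - q / 2 ^ k`, which forces `q ≥ 2 ^ k / 6 ≥ s / 12`: linear in `s`, stronger than
needed. -/

lemma neg_one_pow_val_add (a b : ZMod 2) :
    (-1 : ℝ) ^ (a + b).val = (-1) ^ a.val * (-1) ^ b.val := by
  rw [← pow_add]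
  refine (pow_eq_pow_mod (a + b).val (neg_one_sq (R := ℝ))).trans
    (Eq.trans ?_ (pow_eq_pow_mod (a.val + b.val) (neg_one_sq (R := ℝ))).symm)
  rw [ZMod.val_add, Nat.mod_mod]

lemma chi_comm {n : ℕ} (α x : F2 n) : chi α x = chi x α := by
  simp [chi, dotProduct_comm]

lemma chi_add {n : ℕ} (α x y : F2 n) : chi α (x + y) = chi α x * chi α y := by
  simp [chi, dotProduct_add, neg_one_pow_val_add]

lemma chi_mul_self {n : ℕ} (α x : F2 n) : chi α x * chi α x = 1 := by
  simp [chi, ← mul_pow]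

lemma chi_single {n : ℕ} {α : F2 n} {j : Fin n} (h : α j ≠ 0) :
    chi α (Pi.single j 1) = -1 := by
  have h1 : α j = 1 := by
    generalize α j = a at h
    fin_cases a
    · exact absurd rfl h
    · rfl
  simp [chi, h1, ZMod.val_one]

/-- If `f` is invariant under flipping the `j`-th bit, its Fourier support lies in `α j = 0`. -/
lemma sum_mul_chi_eq_zero {n : ℕ} (f : F2 n → ℝ) {α : F2 n} {j : Fin n} (h : α j ≠ 0)
    (hf : ∀ x, f (x + Pi.single j 1) = f x) : ∑ x, f x * chi α x = 0 := by
  have h1 : ∑ x, f x * chi α x = ∑ x, -(f x * chi α x) := by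
    -- Flipping bit `j` negates `chi α` and fixes `f`, so the sum is its own negative.
    rw [← Equiv.sum_comp (Equiv.addRight (Pi.single j (1 : ZMod 2)))]
    refine sum_congr rfl fun x _ => ?_
    simp [hf, chi_add, chi_single h]
  rw [sum_neg_distrib] at h1
  linarith

lemma sum_chi_mul_chi {n : ℕ} (x y : F2 n) :
    ∑ α, chi α x * chi α y = if x = y then 2 ^ n else 0 := by
  split_ifs with h
  · subst h
    simp [chi_mul_self, ZMod.card]
  · obtain ⟨j, hj⟩ : ∃ j, (x + y) j ≠ 0 := by
      by_contra! h0
      refine h (funext fun j => ?_)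
      have := h0 j
      rwa [Pi.add_apply, CharTwo.add_eq_zero] at this
    simpa [chi_comm, chi_add] using sum_mul_chi_eq_zero (fun _ => 1) hj fun _ => rfl

lemma innerE_self_nonneg {n : ℕ} (f : F2 n → ℝ) : 0 ≤ innerE f f :=
  mul_nonneg (by positivity) (sum_nonneg fun _ _ => mul_self_nonneg _)

lemma l2Norm_sq {n : ℕ} (f : F2 n → ℝ) : l2Norm f ^ 2 = innerE f f :=
  Real.sq_sqrt (innerE_self_nonneg f)

/-- Parseval's identity. -/
lemma sum_fourierCoeff_sq {n : ℕ} (f : F2 n → ℝ) :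
    ∑ α, fourierCoeff f α ^ 2 = innerE f f := by
  have h : ∀ α, fourierCoeff f α ^ 2 =
      (1 / 2 ^ n) ^ 2 * ∑ x, ∑ y, f x * f y * (chi α x * chi α y) := fun α => by
    rw [fourierCoeff, innerE, mul_pow, sq (∑ x, _), sum_mul_sum]
    congr 1
    exact sum_congr rfl fun x _ => sum_congr rfl fun y _ => by ring
  simp_rw [h]
  rw [← mul_sum, sum_comm]
  simp_rw [sum_comm (s := (univ : Finset (F2 n))) (t := (univ : Finset (F2 n)))
    (f := fun α y => f _ * f y * (chi α _ * chi α y)), ← mul_sum, sum_chi_mul_chi]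
  simp only [mul_ite, mul_zero, sum_ite_eq, mem_univ, if_true, ← sum_mul, innerE]
  field_simp

lemma fourierCoeff_sub {n : ℕ} (f g : F2 n → ℝ) (α : F2 n) :
    fourierCoeff (f - g) α = fourierCoeff f α - fourierCoeff g α := by
  simp [fourierCoeff, innerE, sub_mul, mul_sub]

lemma zero_mem_sparse (n s : ℕ) : (0 : F2 n → ℝ) ∈ sparse n s := by
  simp [sparse, fourierCoeff, innerE]

/-- A function with flat Fourier spectrum is far from every sparse function. -/
lemma isFar_sparse_of_flat {n s : ℕ} (hn : 1 ≤ n) (hs : s ≤ 2 ^ (n - 1)) {f : F2 n → ℝ}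
    (hf : ∀ α, fourierCoeff f α ^ 2 = 1 / 2 ^ n) : IsFar (1 / 3) f (sparse n s) := by
  -- As `s ≤ 2 ^ (n - 1)`, `g` has no spectrum on at least half of the frequencies, and `f` has mass
  -- at least `1/2` there.
  have key : Real.sqrt (1 / 2) ≤ l2Dist f (sparse n s) := by
    refine le_csInf ⟨_, 0, zero_mem_sparse n s, rfl⟩ ?_
    rintro _ ⟨g, hg, rfl⟩
    refine Real.sqrt_le_sqrt ?_
    rw [← sum_fourierCoeff_sq]
    classical
    let T : Finset (F2 n) := univ.filter fun α => fourierCoeff g α ≠ 0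
    have hT : T.card ≤ s := by
      have h1 : {α | fourierCoeff g α ≠ 0}.ncard ≤ s := hg
      rwa [← Set.ncard_coe_finset, show (T : Set (F2 n)) = {α | fourierCoeff g α ≠ 0} by
        ext; simp [T]]
    have hcard : T.card + Tᶜ.card = 2 ^ n := by
      rw [card_add_card_compl]; simp [ZMod.card]
    have hpow : 2 ^ n = 2 * 2 ^ (n - 1) := by
      rw [← pow_succ', Nat.sub_add_cancel hn]
    have hle : 2 ^ n ≤ 2 * Tᶜ.card := by omega
    have hle' : (2 : ℝ) ^ n ≤ 2 * (Tᶜ.card : ℝ) := by exact_mod_cast hle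
    calc (1 / 2 : ℝ) ≤ Tᶜ.card * (1 / 2 ^ n) := by
          rw [mul_one_div, div_le_div_iff₀ two_pos (by positivity)]; linarith
      _ = ∑ α ∈ Tᶜ, fourierCoeff (f - g) α ^ 2 := by
          rw [← nsmul_eq_mul, ← sum_const]
          refine sum_congr rfl fun α hα => ?_
          have : fourierCoeff g α = 0 := by simpa [T] using hα
          rw [fourierCoeff_sub, this, sub_zero, hf]
      _ ≤ _ := sum_le_univ_sum_of_nonneg fun _ => sq_nonneg _
  have h := pow_le_pow_left₀ (Real.sqrt_nonneg _) key 2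
  rw [Real.sq_sqrt (by norm_num)] at h
  unfold IsFar
  linarith

open Classical in
/-- The normalized indicator of the subcube of points that agree with `z` on `S`. -/
noncomputable def subcube {n : ℕ} (S : Finset (Fin n)) (z x : F2 n) : ℝ :=
  if ∀ i ∈ S, x i = z i then Real.sqrt (2 ^ S.card) else 0

open Classical in
lemma card_agree {n : ℕ} (S : Finset (Fin n)) (z : F2 n) :
    (univ.filter fun x : F2 n => ∀ i ∈ S, x i = z i).card = 2 ^ Sᶜ.card := by
  have : (univ.filter fun x : F2 n => ∀ i ∈ S, x i = z i) =
      Fintype.piFinset fun i => if i ∈ S then {z i} else univ := by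
    ext x
    simp only [mem_filter, mem_univ, true_and, Fintype.mem_piFinset]
    refine forall_congr' fun i => ?_
    split_ifs with h <;> simp [h]
  rw [this, Fintype.card_piFinset, ← prod_const, ← prod_subset (subset_univ Sᶜ)]
  · exact prod_congr rfl fun i hi => by simp [mem_compl.mp hi, ZMod.card]
  · intro i _ hi
    simp [not_not.mp (mt mem_compl.mpr hi)]

lemma two_pow_card_mul_compl {n : ℕ} (S : Finset (Fin n)) :
    (2 : ℝ) ^ S.card * 2 ^ Sᶜ.card = 2 ^ n := by
  rw [← pow_add, card_add_card_compl, Fintype.card_fin]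

lemma innerE_subcube_self {n : ℕ} (S : Finset (Fin n)) (z : F2 n) :
    innerE (subcube S z) (subcube S z) = 1 := by
  classical
  have h : ∀ x, subcube S z x * subcube S z x =
      if ∀ i ∈ S, x i = z i then 2 ^ S.card else 0 := fun x => by
    unfold subcube
    split_ifs
    · exact Real.mul_self_sqrt (by positivity)
    · simp
  simp_rw [innerE, h, ← sum_filter, sum_const, card_agree, nsmul_eq_mul]
  push_cast
  rw [mul_comm ((2 : ℝ) ^ Sᶜ.card), two_pow_card_mul_compl]
  field_simp

/-- The indicator ignores the coordinates outside `S`, so its spectrum lives on vectors vanishing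
off `S`. -/
lemma subcube_mem_sparse {n s : ℕ} {S : Finset (Fin n)} (hS : 2 ^ S.card ≤ s) (z : F2 n) :
    subcube S z ∈ sparse n s := by
  classical
  have hsub : {α | fourierCoeff (subcube S z) α ≠ 0} ⊆
      ((univ.filter fun α : F2 n => ∀ i ∈ Sᶜ, α i = (0 : F2 n) i : Finset (F2 n)) :
        Set (F2 n)) := by
    intro α hα
    simp only [coe_filter, mem_univ, true_and, Set.mem_ofPred_eq]
    intro j hj
    by_contra h
    refine hα ?_
    rw [fourierCoeff, innerE, sum_mul_chi_eq_zero _ h, mul_zero]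
    intro x
    unfold subcube
    congr 1
    refine propext (forall₂_congr fun i hi => ?_)
    have hij : i ≠ j := fun e => mem_compl.mp hj (e ▸ hi)
    simp [Pi.single_eq_of_ne hij]
  have h := Set.ncard_le_ncard hsub (finite_toSet _)
  rw [Set.ncard_coe_finset, card_agree, compl_compl] at h
  exact h.trans hS

lemma fourierCoeff_subcube_univ_sq {n : ℕ} (z α : F2 n) :
    fourierCoeff (subcube univ z) α ^ 2 = 1 / 2 ^ n := by
  have h : ∀ x, subcube univ z x = if x = z then Real.sqrt (2 ^ n) else 0 := fun x => by
    simp [subcube, funext_iff]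
  simp_rw [fourierCoeff, innerE, h, ite_mul, zero_mul, sum_ite_eq', mem_univ, if_true]
  rw [mul_pow, mul_pow, Real.sq_sqrt (by positivity), sq (chi _ _), chi_mul_self]
  field_simp

/-- A non-adaptive algorithm is unlikely to hit a suitably translated subcube. -/
lemma exists_prob_hit_le {n q : ℕ} (A : NonAdaptiveAlgorithm n q) (S : Finset (Fin n)) :
    letI := A.measurableSpace
    ∃ z : F2 n, A.law.real {ω | ∃ i, ∀ j ∈ S, A.query ω i j = z j} ≤ q / 2 ^ S.card := by
  classical
  let _ := A.measurableSpace
  have := A.isProbabilityMeasure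
  let p : (Fin q → F2 n) → ℝ := fun ξ => A.law.real {ω | A.query ω = ξ}
  have hp : ∑ ξ, p ξ = 1 := by
    rw [← measureReal_biUnion_finset (fun ξ _ η _ h => Set.disjoint_left.mpr
      fun ω h1 h2 => h (h1.symm.trans h2)) fun ξ _ => A.measurableSet_query ξ]
    rw [show (⋃ ξ ∈ (univ : Finset (Fin q → F2 n)), {ω | A.query ω = ξ}) = Set.univ by
      ext; simp]
    simp
  -- Union bound over the query tuple `ξ` and the index `i` of a query that hits.
  have hz : ∀ z : F2 n, A.law.real {ω | ∃ i, ∀ j ∈ S, A.query ω i j = z j} ≤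
      ∑ ξ, ∑ i, if ∀ j ∈ S, z j = ξ i j then p ξ else 0 := by
    intro z
    have hsub : {ω | ∃ i, ∀ j ∈ S, A.query ω i j = z j} ⊆
        ⋃ ξ ∈ univ.filter (fun ξ : Fin q → F2 n => ∃ i, ∀ j ∈ S, ξ i j = z j),
          {ω | A.query ω = ξ} := fun ω hω => by
      simpa using hω
    refine (measureReal_mono hsub (measure_ne_top _ _)).trans ((measureReal_biUnion_finset_le _ _).trans ?_)
    rw [sum_filter]
    refine sum_le_sum fun ξ _ => ?_
    have hnn : ∀ i ∈ univ, 0 ≤ if ∀ j ∈ S, z j = ξ i j then p ξ else 0 := fun i _ => by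
      split_ifs
      exacts [measureReal_nonneg, le_rfl]
    split_ifs with h
    · obtain ⟨i, hi⟩ := h
      refine le_trans ?_ (single_le_sum hnn (mem_univ i))
      rw [if_pos fun j hj => (hi j hj).symm]
    · exact sum_nonneg hnn
  by_contra! hcon
  have h1 : ∑ _z : F2 n, (q : ℝ) / 2 ^ S.card <
      ∑ z : F2 n, ∑ ξ, ∑ i, if ∀ j ∈ S, z j = ξ i j then p ξ else 0 :=
    sum_lt_sum_of_nonempty univ_nonempty fun z _ => (hcon z).trans_le (hz z)
  -- Each query point lies in the subcube for exactly `2 ^ Sᶜ.card` values of `z`.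
  have h2 : ∑ z : F2 n, ∑ ξ, ∑ i, (if ∀ j ∈ S, z j = ξ i j then p ξ else 0) =
      q * 2 ^ Sᶜ.card := by
    rw [sum_comm]
    have : ∀ ξ, ∑ z : F2 n, ∑ i, (if ∀ j ∈ S, z j = ξ i j then p ξ else 0) =
        (q * 2 ^ Sᶜ.card) * p ξ := fun ξ => by
      rw [sum_comm]
      simp_rw [← sum_filter, sum_const, card_agree]
      simp [mul_assoc]
    simp_rw [this, ← mul_sum, hp, mul_one]
  rw [h2, sum_const, card_univ, nsmul_eq_mul] at h1
  have h3 : ((Fintype.card (F2 n) : ℕ) : ℝ) = 2 ^ S.card * 2 ^ Sᶜ.card := by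
    rw [two_pow_card_mul_compl]; simp [ZMod.card]
  rw [h3] at h1
  refine h1.ne ?_
  field_simp

/-- Away from the event of hitting the support of `f`, the algorithm behaves as on `0`. -/
lemma prob_le_prob_zero_add {n q : ℕ} (A : NonAdaptiveAlgorithm n q) (S : Finset (Fin n))
    (z : F2 n) (b : Bool) :
    letI := A.measurableSpace
    A.prob (subcube S z) b ≤
      A.prob 0 b + A.law.real {ω | ∃ i, ∀ j ∈ S, A.query ω i j = z j} := by
  let _ := A.measurableSpace
  have := A.isProbabilityMeasure
  refine (measureReal_mono ?_).trans (measureReal_union_le _ _)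
  intro ω hω
  by_cases h : ∃ i, ∀ j ∈ S, A.query ω i j = z j
  · exact Or.inr h
  · left
    have h0 : (fun i => subcube S z (A.query ω i)) = fun i => (0 : F2 n → ℝ) (A.query ω i) :=
      funext fun i => if_neg (not_exists.mp h i)
    have h1 : A.output ω (fun i => subcube S z (A.query ω i)) = b := hω
    rw [h0] at h1
    exact h1

lemma prob_zero_add_prob_zero {n q : ℕ} (A : NonAdaptiveAlgorithm n q) :
    A.prob 0 true + A.prob 0 false = 1 := by
  let _ := A.measurableSpace
  have := A.isProbabilityMeasure
  have hm : MeasurableSet {ω | A.run 0 ω = true} :=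
    (A.measurable_output.comp (measurable_id.prodMk measurable_const))
      (measurableSet_singleton true)
  have hc : {ω | A.run 0 ω = false} = {ω | A.run 0 ω = true}ᶜ := by
    ext ω; simp
  unfold NonAdaptiveAlgorithm.prob
  rw [hc, measureReal_add_measureReal_compl hm]
  simp

/-- The input `0` is only a reference point: it need not satisfy the norm condition. -/
lemma exists_two_thirds_le_prob_zero_add {n q : ℕ} (A : NonAdaptiveAlgorithm n q)
    (S : Finset (Fin n)) (b : Bool) (h : ∀ z, 2 / 3 ≤ A.prob (subcube S z) b) :
    2 / 3 ≤ A.prob 0 b + q / 2 ^ S.card := by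
  obtain ⟨z, hz⟩ := exists_prob_hit_le A S
  have h1 := prob_le_prob_zero_add A S z b
  have h2 := h z
  linarith

/-- Distinguishing sparse from far functions takes even `s / 12` non-adaptive queries. -/
theorem NonAdaptiveAlgorithm.Distinguishes.le_queries {n s q : ℕ} (hn : 1 ≤ n) (hs : s ≤ 2 ^ (n - 1)) {ε : ℝ}
    (hε : 0 < ε) (A : NonAdaptiveAlgorithm n q) (hA : A.Distinguishes (sparse n s) (1 / 3) ε) :
    (s : ℝ) / 12 ≤ q := by
  rcases Nat.eq_zero_or_pos s with rfl | hs0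
  · simp
  have hnorm : ∀ (S : Finset (Fin n)) z, |l2Norm (subcube S z) ^ 2 - 1| ≤ ε := fun S z => by
    rw [l2Norm_sq, innerE_subcube_self, sub_self, abs_zero]
    exact hε.le
  have hle : 2 ^ Nat.log 2 s ≤ s := Nat.pow_log_le_self 2 hs0.ne'
  have hlt : s < 2 ^ (Nat.log 2 s + 1) := Nat.lt_pow_succ_log_self one_lt_two s
  have hk : Nat.log 2 s ≤ n :=
    ((Nat.pow_le_pow_iff_right one_lt_two).mp (hle.trans hs)).trans (Nat.sub_le _ _)
  obtain ⟨S, -, hS⟩ := exists_subset_card_eq (s := (univ : Finset (Fin n)))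
    (n := Nat.log 2 s) (by simpa using hk)
  have h1 := exists_two_thirds_le_prob_zero_add A S true fun z =>
    (hA _ (hnorm S z)).1 (subcube_mem_sparse (hS ▸ hle) z)
  have h2 := exists_two_thirds_le_prob_zero_add A univ false fun z =>
    (hA _ (hnorm univ z)).2 (isFar_sparse_of_flat hn hs (fourierCoeff_subcube_univ_sq z))
  have h3 := prob_zero_add_prob_zero A
  rw [hS] at h1
  have h4 : (q : ℝ) / 2 ^ (univ : Finset (Fin n)).card ≤ q / 2 ^ Nat.log 2 s := by
    rw [card_univ, Fintype.card_fin]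
    gcongr
    exact one_le_two
  -- Adding `h1` and `h2` gives `4/3 ≤ 1 + 2q / 2 ^ k`.
  have h5 : (1 / 6 : ℝ) ≤ q / 2 ^ Nat.log 2 s := by linarith
  rw [le_div_iff₀ (by positivity)] at h5
  have h6 : (s : ℝ) < 2 ^ Nat.log 2 s * 2 := by
    rw [← pow_succ]; exact_mod_cast hlt
  linarith

end FourierSparsity

theorem mainTheorem2 :
    ∃ c : ℝ, 0 < c ∧
      ∀ (n s : ℕ), 1 ≤ n → s ≤ 2 ^ (n - 1) →
        ∀ ε : ℝ, 0 < ε →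
          ∀ (q : ℕ) (A : FourierSparsity.NonAdaptiveAlgorithm n q),
            A.Distinguishes (FourierSparsity.sparse n s) (1 / 3) ε →
              c * Real.sqrt s ≤ q := by
  refine ⟨1 / 12, by norm_num, fun n s hn hs ε hε q A hA => ?_⟩
  have h := FourierSparsity.NonAdaptiveAlgorithm.Distinguishes.le_queries hn hs hε A hA
  -- True because `s` is a natural number.
  have hsq : Real.sqrt s ≤ s := by
    rw [Real.sqrt_le_left (Nat.cast_nonneg s)]
    exact_mod_cast Nat.le_self_pow two_ne_zero s
  linarith
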